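/- **Theorem (Uniform Convergence Theorem for the Net Riemann integral).** *Conventions.* A directed set is nonempty and upwards directed. A *Boccuto–Candeloro convergence structure* $\eta$ on a (real) Riesz space specifies which nets converge to which points, subject to: (i) $x_i\to x$ and $y_j\to y$ imply $x_i+y_j\to x+y$ along the product index set, and if $x_i\to x$, $y_i\to y$ and $x_i\le y_i$ for a cofinal set of $i$, then $x\le y$; (ii) $x_i\to x$ implies $|x_i|\to|x|$; (iii) if $x_i\to x$, $y_i\to x$ and eventually $x_i\le z_i\le y_i$, then $z_i\to x$; (iv) if a sequence $x_n$ converges, then $\frac1n x_n\to 0$; (v) constant nets converge to their value; (vi) if $x_i\to x$, then every quasi-subnet converges to $x$ (a net $y_j$ is a quasi-subnet of $x_i$ if every tail of $x_i$ contains, as a set, a tail of $y_j$); (vii) if $x_i\to x$, $y_i\to x$ and $z_i\in\{x_i,y_i\}$ for all $i$, then $z_i\to x$. It has the *monotone convergence property for sequences* if every non-decreasing sequence that has a supremum converges to it. In a Riesz space $Z$, a *regulator* is an order bounded double sequence $(a_{ij})$ with $a_{i,j}\ge a_{i,j+1}$ and $\bigwedge_j a_{ij}=0$ for every $i$. A net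 $(z_i)_{i\in I}$ is *$(D)$-convergent* to $z$ if there is a regulator $(a_{ij})$ such that for every $\varphi\in\mathbb N^{\mathbb N}$ the supremum $\bigvee_j a_{j\varphi(j)}$ exists and there is $i_0\in I$ with $|z_i-z|\le\bigvee_j a_{j\varphi(j)}$ for all $i\ge i_0$. $Z$ is *Dedekind complete* if every nonempty subset that is bounded above has a supremum; such a $Z$ is *weakly $\sigma$-distributive* if $\bigwedge_{\varphi\in\mathbb N^{\mathbb N}}\bigvee_j a_{j\varphi(j)}=0$ for every regulator. A net $(z_i)$ *order converges* to $z$ if there are a non-decreasing net $(p_c)_{c\in C}$ and a non-increasing net $(q_c)_{c\in C}$ over one directed set $C$ with $\sup_c p_c=z=\inf_c q_c$ such that for every $c$ eventually $p_c\le z_i\le q_c$. *Setting.* Let $X,Y,Z$ be Riesz spaces, with $Z$ Dedekind complete and weakly $\sigma$-distributive. Let $X$ and $Y$ carry Boccuto–Candeloro convergence structures $\eta_1,\eta_2$, where $\eta_1$ has the monotone convergence property for sequences, and let $Z$ carry $(D)$-convergence. Let $\bullet\colon X\times Y\to Z$ be a bilinear map, isotone on $X^+\times Y^+$, all of whose partial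 maps $x\mapsto x\bullet y$ and $y\mapsto x\bullet y$ are continuous (they send nets converging to a point to nets converging to its image). Let $\Omega$ be a set, $\mathcal H$ a family of subsets of $\Omega$ with $\emptyset,\Omega\in\mathcal H$, and $\Gamma$ a directed set. For each $\gamma\in\Gamma$ let $(\sigma_{\gamma,i})_{i\in I_\gamma}$ and $(\tau_{\gamma,i})_{i\in I_\gamma}$ be families of elements of $\mathcal H$ and of points of $\Omega$ with the same finite index set. For $f\colon\Omega\to X$ and $\mu\colon\mathcal H\to Y$ put $$S_\gamma(f,\mu)=\sum_{i\in I_\gamma} f(\tau_{\gamma,i})\bullet\mu(\sigma_{\gamma,i}).$$ The function $f$ is *Net Riemann integrable* with respect to $\mu$ if the net $(S_\gamma(f,\mu))_{\gamma\in\Gamma}$ is $(D)$-convergent in $Z$; its limit is denoted $\int_\Omega f\,d\mu$. The set function $\mu$ is a *regular integrator* if $\int_\Omega\mathbb 1_A\,d\mu=\mu(A)$ for every $A\in\mathcal H$, that is, if $\sum_{i\in I_\gamma}\mathbb 1_A(\tau_{\gamma,i})\,\mu(\sigma_{\gamma,i})\to\mu(A)$ in $(Y,\eta_2)$ along $\Gamma$,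 with $\mathbb 1_A$ the real-valued indicator function. *Statement.* Let $\mu\colon\mathcal H\to Y^+$ be a regular integrator, and let $f_n\colon\Omega\to X$ $(n\in\mathbb N)$ be Net Riemann integrable with respect to $\mu$. Suppose that $f_n$ converges order uniformly to $f\colon\Omega\to X$: there is a non-increasing sequence $(u_n)$ in $X^+$ with $\bigwedge_n u_n=0$ and $|f_n(\omega)-f(\omega)|\le u_n$ for all $n$ and all $\omega\in\Omega$. Then $f$ is Net Riemann integrable with respect to $\mu$, and the sequence $\int_\Omega f_n\,d\mu$ order converges in $Z$ to $\int_\Omega f\,d\mu$. -/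

import Mathlib

open Set

universe w

namespace NetRiemann

/-- Order (Dedekind) completeness: every nonempty set that is bounded above has a supremum. -/
def DedekindComplete (Z : Type*) [Preorder Z] : Prop :=
  ∀ s : Set Z, s.Nonempty → BddAbove s → ∃ a, IsLUB s a

/-! ### Regulators and weak σ-distributivity -/

/-- A `(D)`-sequence, or regulator: an order bounded double sequence `a i j` that for every `i` is
non-increasing in `j` with infimum `0`. -/
structure IsRegulator {Z : Type*} [Preorder Z] [Zero Z] (a : ℕ → ℕ → Z) : Prop where
  bddAbove : ∃ b, ∀ i j, a i j ≤ b
  antitone : ∀ i, Antitone (a i)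
  isGLB : ∀ i, IsGLB (range (a i)) 0

/-- Weak σ-distributivity: for every regulator `a`, the infimum over all `φ : ℕ → ℕ` of the suprema
`⋁ i, a i (φ i)` is `0`. -/
def WeaklySigmaDistributive (Z : Type*) [Preorder Z] [Zero Z] : Prop :=
  ∀ a : ℕ → ℕ → Z, IsRegulator a →
    IsGLB {s : Z | ∃ φ : ℕ → ℕ, IsLUB (range fun i => a i (φ i)) s} 0

/-! ### Convergence of nets -/

/-- A notion of convergence of nets in `X`: `η I x l` says that the net `x`, indexed by the
(nonempty, upwards) directed set `I`, converges to `l`. -/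
def NetLim (X : Type*) : Type _ :=
  ∀ (I : Type w) [Preorder I] [IsDirectedOrder I] [Nonempty I], (I → X) → X → Prop

instance isDirectedOrder_prod {I J : Type*} [Preorder I] [IsDirectedOrder I]
    [Preorder J] [IsDirectedOrder J] : IsDirectedOrder (I × J) :=
  ⟨fun p q => by
    obtain ⟨i, hi, hi'⟩ := exists_ge_ge p.1 q.1
    obtain ⟨j, hj, hj'⟩ := exists_ge_ge p.2 q.2
    exact ⟨(i, j), ⟨hi, hj⟩, ⟨hi', hj'⟩⟩⟩

/-- `y` is a quasi-subnet of `x`: every tail of `x` contains a tail of `y`. -/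
def IsQuasiSubnet {X I J : Type*} [Preorder I] [Preorder J] (y : J → X) (x : I → X) : Prop :=
  ∀ i₀ : I, ∃ j₀ : J, y '' Ici j₀ ⊆ x '' Ici i₀

/-- The axioms of a Boccuto–Candeloro net convergence structure on a Riesz space. Limits are
automatically unique, by `le_of_le` and antisymmetry of the order. -/
structure IsBoccutoCandeloro {X : Type*} [AddCommGroup X] [Lattice X] [Module ℝ X]
    (η : NetLim.{w} X) : Prop where
  add : ∀ (I J : Type w) [Preorder I] [IsDirectedOrder I] [Nonempty I]
    [Preorder J] [IsDirectedOrder J] [Nonempty J] (x : I → X) (y : J → X) (a b : X),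
    η I x a → η J y b → η (I × J) (fun p => x p.1 + y p.2) (a + b)
  /-- Limits preserve an inequality that holds on a cofinal set of indices. -/
  le_of_le : ∀ (I : Type w) [Preorder I] [IsDirectedOrder I] [Nonempty I] (x y : I → X) (a b : X),
    η I x a → η I y b → (∀ i₀, ∃ i, i₀ ≤ i ∧ x i ≤ y i) → a ≤ b
  abs : ∀ (I : Type w) [Preorder I] [IsDirectedOrder I] [Nonempty I] (x : I → X) (a : X),
    η I x a → η I (fun i => |x i|) |a|
  squeeze : ∀ (I : Type w) [Preorder I] [IsDirectedOrder I] [Nonempty I] (x y z : I → X) (a : X),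
    η I x a → η I y a → (∃ i₀, ∀ i, i₀ ≤ i → x i ≤ z i ∧ z i ≤ y i) → η I z a
  inv_smul : ∀ (x : ULift.{w} ℕ → X) (a : X), η (ULift.{w} ℕ) x a →
    η (ULift.{w} ℕ) (fun n => ((n.down : ℝ) + 1)⁻¹ • x n) 0
  const : ∀ (I : Type w) [Preorder I] [IsDirectedOrder I] [Nonempty I] (a : X),
    η I (fun _ => a) a
  quasiSubnet : ∀ (I J : Type w) [Preorder I] [IsDirectedOrder I] [Nonempty I]
    [Preorder J] [IsDirectedOrder J] [Nonempty J] (x : I → X) (y : J → X) (a : X),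
    η I x a → IsQuasiSubnet y x → η J y a
  mix : ∀ (I : Type w) [Preorder I] [IsDirectedOrder I] [Nonempty I] (x y z : I → X) (a : X),
    η I x a → η I y a → (∀ i, z i = x i ∨ z i = y i) → η I z a

/-- The monotone convergence property for sequences: a non-decreasing sequence that has a supremum
converges to its supremum. -/
def SequentialMCP {X : Type*} [Preorder X] (η : NetLim.{w} X) : Prop :=
  ∀ (x : ULift.{w} ℕ → X) (s : X), Monotone x → IsLUB (range x) s → η (ULift.{w} ℕ) x s

/-- A map is continuous if it sends convergent nets to convergent nets, with the image limit. -/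
def NetContinuous {X Y : Type*} (η₁ : NetLim.{w} X) (η₂ : NetLim.{w} Y) (g : X → Y) : Prop :=
  ∀ (I : Type w) [Preorder I] [IsDirectedOrder I] [Nonempty I] (x : I → X) (a : X),
    η₁ I x a → η₂ I (fun i => g (x i)) (g a)

/-- `(D)`-convergence: there is a regulator `a` such that for every `φ : ℕ → ℕ` one has, eventually,
`|x i - l| ≤ ⋁ j, a j (φ j)`. -/
def DLim {Z : Type*} [AddCommGroup Z] [Lattice Z] : NetLim.{w} Z :=
  fun I _ _ _ x l => ∃ a : ℕ → ℕ → Z, IsRegulator a ∧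
    ∀ φ : ℕ → ℕ, ∃ s, IsLUB (range fun j => a j (φ j)) s ∧ ∃ i₀ : I, ∀ i, i₀ ≤ i → |x i - l| ≤ s

/-- Order convergence: the net is eventually between `z c` and `y c` for every `c`, where `z` is a
non-decreasing net with supremum `l` and `y` is a non-increasing net with infimum `l`. -/
def OLim {Z : Type*} [Preorder Z] : NetLim.{w} Z :=
  fun I _ _ _ x l => ∃ (C : Type w) (_ : Preorder C) (_ : IsDirectedOrder C) (_ : Nonempty C)
    (z y : C → Z), Monotone z ∧ Antitone y ∧ IsLUB (range z) l ∧ IsGLB (range y) l ∧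
    ∀ c, ∃ i₀ : I, ∀ i, i₀ ≤ i → z c ≤ x i ∧ x i ≤ y c

/-- Order uniform convergence of a sequence of functions. -/
def OrderUniformLim {Ω X : Type*} [AddCommGroup X] [Lattice X]
    (f : ℕ → Ω → X) (g : Ω → X) : Prop :=
  ∃ u : ℕ → X, (∀ n, 0 ≤ u n) ∧ Antitone u ∧ IsGLB (range u) 0 ∧ ∀ n ω, |f n ω - g ω| ≤ u n

/-! ### Products and the net Riemann integral -/

/-- A bilinear map `B : X × Y → Z` is a product for given convergence structures if it is isotone on
the positive cones and continuous in each argument. -/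
structure IsProduct {X Y Z : Type*} [AddCommGroup X] [Lattice X] [Module ℝ X]
    [AddCommGroup Y] [Lattice Y] [Module ℝ Y] [AddCommGroup Z] [Lattice Z] [Module ℝ Z]
    (η₁ : NetLim.{w} X) (η₂ : NetLim.{w} Y) (η₃ : NetLim.{w} Z)
    (B : X →ₗ[ℝ] Y →ₗ[ℝ] Z) : Prop where
  isotone : ∀ ⦃x x' : X⦄ ⦃y y' : Y⦄, 0 ≤ x → x ≤ x' → 0 ≤ y → y ≤ y' → B x y ≤ B x' y'
  continuous_left : ∀ y : Y, NetContinuous η₁ η₃ fun x => B x y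
  continuous_right : ∀ x : X, NetContinuous η₂ η₃ fun y => B x y

/-- A Fleischer–Szabó–Száz net on `(Ω, H)`, indexed by `Γ`: to every `γ : Γ` are attached a finite
family `σ γ` of sets in `H` and a family `τ γ` of points of `Ω`, with the same finite index set. -/
structure IntegrationNet {Ω : Type*} (H : Set (Set Ω)) (Γ : Type*) where
  ι : Γ → Type
  fintype : ∀ γ, Fintype (ι γ)
  σ : ∀ γ, ι γ → H
  τ : ∀ γ, ι γ → Ω

section Integral

variable {Ω : Type*} {H : Set (Set Ω)} {Γ : Type w}
  {X Y Z : Type*} [AddCommGroup X] [Module ℝ X] [AddCommGroup Y] [Module ℝ Y]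
  [AddCommGroup Z] [Module ℝ Z]

/-- The Riemann sum `∑ i, B (f (τ γ i)) (μ (σ γ i))`. -/
def riemannSum (B : X →ₗ[ℝ] Y →ₗ[ℝ] Z) (N : IntegrationNet H Γ) (f : Ω → X) (μ : H → Y)
    (γ : Γ) : Z :=
  letI := N.fintype γ
  ∑ i, B (f (N.τ γ i)) (μ (N.σ γ i))

variable [Preorder Γ] [IsDirectedOrder Γ] [Nonempty Γ]

/-- `L` is the net Riemann integral of `f` with respect to `μ`, limits being taken in `η`. -/
def HasNetIntegral (η : NetLim.{w} Z) (B : X →ₗ[ℝ] Y →ₗ[ℝ] Z) (N : IntegrationNet H Γ)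
    (f : Ω → X) (μ : H → Y) (L : Z) : Prop :=
  η Γ (riemannSum B N f μ) L

def NetIntegrable (η : NetLim.{w} Z) (B : X →ₗ[ℝ] Y →ₗ[ℝ] Z) (N : IntegrationNet H Γ)
    (f : Ω → X) (μ : H → Y) : Prop :=
  ∃ L, HasNetIntegral η B N f μ L

open Classical in
/-- The net Riemann integral (with value `0` if `f` is not integrable). -/
noncomputable def netIntegral (η : NetLim.{w} Z) (B : X →ₗ[ℝ] Y →ₗ[ℝ] Z) (N : IntegrationNet H Γ)
    (f : Ω → X) (μ : H → Y) : Z :=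
  if h : NetIntegrable η B N f μ then h.choose else 0

/-- `μ` is a regular integrator: `∫ 1_A dμ = μ A` for all `A` in `H`. Here `1_A` is the real-valued
indicator function, the product is scalar multiplication `ℝ × Y → Y`, and the limit is taken in the
convergence structure of `Y`. -/
def IsRegularIntegrator (η : NetLim.{w} Y) (N : IntegrationNet H Γ) (μ : H → Y) : Prop :=
  ∀ A : H, HasNetIntegral η (LinearMap.lsmul ℝ Y) N ((A : Set Ω).indicator fun _ => (1 : ℝ)) μ (μ A)

end Integral

end NetRiemann

open NetRiemann

namespace NetRiemann

open Filter

/-! ### Truncation and suprema in Riesz spaces -/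

section RieszSpace

variable {Z : Type*} [AddCommGroup Z] [Lattice Z]

/-! Put `v n = B (u n) (μ Ω)`. Regularity at `Ω` and continuity of `B x` show that a constant `x`
has integral `B x (μ Ω)`; monotone convergence applied to `-u n`, with continuity in the other
variable, gives `v n ↓ 0`. Since `μ ≥ 0`, the Riemann sums of `f n` and `g` differ by at most the
sum of the constant `u n`, whose limit is `v n`. Hence the integrals `L n` satisfy `L n - L k ≤ v n
+ v k`, and Dedekind completeness yields `l` with `|L n - l| ≤ v n`.

It follows that `|S g - l| ≤ 2 v n + |S (f n) - L n| + |S (u n) - v n|` for every `n`. The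
difficulty is that each `n` brings its own regulators, while `(D)`-convergence of `S g` needs a
single one. Countably many rows can be merged if they are all truncated at one eventual bound of `|S
g - l|`, which makes the merged array order bounded (`DLim.of_countable`, `DLim.of_approx`). -/

theorem abs_le_of_le_of_neg_le {a b : Z} (h : a ≤ b) (h' : -a ≤ b) : |a| ≤ b :=
  sup_le h h'

variable [IsOrderedAddMonoid Z]

theorem abs_add_le_add_abs (a b : Z) : |a + b| ≤ |a| + |b| := by
  refine abs_le_of_le_of_neg_le (add_le_add (le_abs_self a) (le_abs_self b)) ?_
  rw [neg_add]
  exact add_le_add (neg_le_abs a) (neg_le_abs b)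

theorem le_zero_of_forall_le_add {A C : Set Z} (hA : IsGLB A 0) (hC : IsGLB C 0) {t : Z}
    (h : ∀ a ∈ A, ∀ c ∈ C, t ≤ a + c) : t ≤ 0 := by
  refine hC.2 fun c hc => ?_
  have : t - c ≤ 0 := hA.2 fun a ha => sub_le_iff_le_add.2 (h a ha c hc)
  exact sub_nonpos.1 this

variable [Module ℝ Z] [IsOrderedModule ℝ Z]

theorem isGLB_range_smul {x : ℕ → Z} (hx : IsGLB (range x) 0) {r : ℝ} (hr : 0 < r) :
    IsGLB (range fun l => r • x l) 0 := by
  refine ⟨?_, fun t ht => ?_⟩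
  · rintro _ ⟨l, rfl⟩
    exact smul_nonneg hr.le (hx.1 ⟨l, rfl⟩)
  · have h : r⁻¹ • t ≤ 0 := hx.2 <| by
      rintro _ ⟨l, rfl⟩
      simpa [smul_smul, hr.ne'] using smul_le_smul_of_nonneg_left (ht ⟨l, rfl⟩) (inv_pos.2 hr).le
    simpa [smul_smul, hr.ne'] using smul_le_smul_of_nonneg_left h hr.le

/-- Truncation commutes with suprema: since `u ⊓ w = u + w - u ⊔ w`, the hypothesis bounds `r • y j`
by `s + (u ⊔ r • b) - u`, which does not depend on `j`. -/
theorem inf_smul_le_of_isLUB {y : ℕ → Z} {b u s : Z} {r : ℝ} (hr : 0 < r)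
    (hb : IsLUB (range y) b) (h : ∀ j, u ⊓ r • y j ≤ s) : u ⊓ r • b ≤ s := by
  have key : b ≤ r⁻¹ • (s + (u ⊔ r • b) - u) := hb.2 <| by
    rintro _ ⟨j, rfl⟩
    have h1 : r • y j ≤ s + (u ⊔ r • b) - u := by
      have h2 : u ⊔ r • y j ≤ u ⊔ r • b :=
        sup_le_sup_left (smul_le_smul_of_nonneg_left (hb.1 ⟨j, rfl⟩) hr.le) u
      rw [le_sub_iff_add_le, add_comm, ← inf_add_sup]
      exact add_le_add (h j) h2
    simpa [smul_smul, hr.ne'] using smul_le_smul_of_nonneg_left h1 (inv_pos.2 hr).le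
  have h3 : r • b ≤ s + (u ⊔ r • b) - u := by
    simpa [smul_smul, hr.ne'] using smul_le_smul_of_nonneg_left key hr.le
  rw [le_sub_iff_add_le, add_comm, ← inf_add_sup] at h3
  exact le_of_add_le_add_right h3

theorem add_add_le_sup_smul (x y z : Z) :
    x + y + z ≤ (3 : ℝ) • x ⊔ (3 : ℝ) • y ⊔ (3 : ℝ) • z := by
  set w := (3 : ℝ) • x ⊔ (3 : ℝ) • y ⊔ (3 : ℝ) • z
  have aux : ∀ a : Z, (3 : ℝ) • a ≤ w → a ≤ (3 : ℝ)⁻¹ • w := fun a ha => by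
    simpa [smul_smul] using
      smul_le_smul_of_nonneg_left ha (by norm_num : (0 : ℝ) ≤ (3 : ℝ)⁻¹)
  calc x + y + z ≤ (3 : ℝ)⁻¹ • w + (3 : ℝ)⁻¹ • w + (3 : ℝ)⁻¹ • w :=
        add_le_add (add_le_add (aux x (le_sup_left.trans le_sup_left))
          (aux y (le_sup_right.trans le_sup_left))) (aux z le_sup_right)
    _ = w := by rw [← add_smul, ← add_smul]; norm_num

/-- A sum of three terms is at most the supremum of their triples, and the lattice is distributive.
This turns a sum of errors into a supremum of truncated rows, the form a regulator controls. -/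
theorem le_of_inf_smul_le {u x y z s t : Z} (htu : t ≤ u) (ht : t ≤ x + y + z)
    (hx : u ⊓ (3 : ℝ) • x ≤ s) (hy : u ⊓ (3 : ℝ) • y ≤ s) (hz : u ⊓ (3 : ℝ) • z ≤ s) :
    t ≤ s := by
  let _ : DistribLattice Z := AddCommGroup.toDistribLattice Z
  have h := le_inf htu (ht.trans (add_add_le_sup_smul x y z))
  rw [inf_sup_left, inf_sup_left] at h
  exact h.trans (sup_le (sup_le hx hy) hz)

end RieszSpace

/-! ### Uniqueness and merging of regulators for `(D)`-convergence -/

section DConvergence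

variable {Z : Type*} [AddCommGroup Z] [Lattice Z]
  {I : Type w} [Preorder I] [IsDirectedOrder I] [Nonempty I]

theorem DLim.exists_isGLB (hZ' : WeaklySigmaDistributive Z) {x : I → Z} {l : Z}
    (h : DLim I x l) :
    ∃ A : Set Z, IsGLB A 0 ∧ ∀ s ∈ A, ∀ᶠ i in atTop, |x i - l| ≤ s := by
  obtain ⟨a, ha, h⟩ := h
  refine ⟨_, hZ' a ha, ?_⟩
  rintro s ⟨φ, hs⟩
  obtain ⟨s', hs', h⟩ := h φ
  rw [hs.unique hs']
  exact eventually_atTop.2 h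

variable [IsOrderedAddMonoid Z]

theorem DLim.unique (hZ' : WeaklySigmaDistributive Z) {x : I → Z} {l l' : Z}
    (h : DLim I x l) (h' : DLim I x l') : l = l' := by
  obtain ⟨A, hA, h⟩ := h.exists_isGLB hZ'
  obtain ⟨A', hA', h'⟩ := h'.exists_isGLB hZ'
  have key : |l - l'| ≤ 0 := le_zero_of_forall_le_add hA hA' fun a ha c hc => by
    obtain ⟨i, hi, hi'⟩ := ((h a ha).and (h' c hc)).exists
    calc |l - l'| = |(l - x i) + (x i - l')| := by congr 1; abel
      _ ≤ |l - x i| + |x i - l'| := abs_add_le_add_abs _ _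
      _ ≤ a + c := add_le_add (by rwa [abs_sub_comm]) hi'
  exact sub_nonpos.1 ((le_abs_self _).trans key) |>.antisymm
    (sub_nonpos.1 (by rw [← neg_sub]; exact (neg_le_abs _).trans key))

/-- A net that is eventually within `u` of `l` is `(D)`-convergent to `l` as soon as it is
controlled by a countable family of sequences decreasing to `0`, truncated at `u`. -/
theorem DLim.of_countable (hZ : DedekindComplete Z) {κ : Type*} [Countable κ] [Nonempty κ]
    {c : κ → ℕ → Z} (hc : ∀ k, Antitone (c k)) (hc' : ∀ k, IsGLB (range (c k)) 0)
    {u : Z} (hu : 0 ≤ u) {x : I → Z} {l : Z}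
    (h : ∀ (Φ : κ → ℕ) (s : Z), (∀ k, u ⊓ c k (Φ k) ≤ s) → ∀ᶠ i in atTop, |x i - l| ≤ s) :
    DLim I x l := by
  obtain ⟨e, he⟩ := exists_surjective_nat κ
  refine ⟨fun k j => u ⊓ c (e k) j,
    ⟨⟨u, fun _ _ => inf_le_left⟩, fun k i j hij => inf_le_inf_left u (hc _ hij), fun k => ⟨?_, ?_⟩⟩,
    fun φ => ?_⟩
  · rintro _ ⟨j, rfl⟩
    exact le_inf hu ((hc' _).1 ⟨j, rfl⟩)
  · intro t ht
    refine (hc' (e k)).2 ?_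
    rintro _ ⟨j, rfl⟩
    exact (ht ⟨j, rfl⟩).trans inf_le_right
  · obtain ⟨s, hs⟩ := hZ (range fun j => u ⊓ c (e j) (φ j)) (range_nonempty _)
      ⟨u, by rintro _ ⟨j, rfl⟩; exact inf_le_left⟩
    -- The enumeration `e` may repeat; one row per `k` suffices, chosen by `surjInv`.
    refine ⟨s, hs, eventually_atTop.1 (h (fun k => φ (Function.surjInv he k)) s fun k => ?_)⟩
    have := hs.1 ⟨Function.surjInv he k, rfl⟩
    simpa only [Function.surjInv_eq he k] using this

/-- If `x` is approximated, up to errors `v n` decreasing to `0`, by null nets for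
`(D)`-convergence, then `x` is `(D)`-convergent. -/
theorem DLim.of_approx [Module ℝ Z] [IsOrderedModule ℝ Z] (hZ : DedekindComplete Z)
    {x : I → Z} {l : Z} {y z : ℕ → I → Z} {b d v : ℕ → Z}
    (hy : ∀ n, DLim I (y n) (b n)) (hz : ∀ n, DLim I (z n) (d n))
    (hv : Antitone v) (hv' : IsGLB (range v) 0)
    (h : ∀ n i, |x i - l| ≤ v n + |y n i - b n| + |z n i - d n|) : DLim I x l := by
  choose α hα hyα using hy
  choose β hβ hzβ using hz
  -- The truncation level comes from the estimate at `n = 0`, with `φ = 0` in both regulators.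
  obtain ⟨u, hu⟩ : ∃ u, ∀ᶠ i in atTop, |x i - l| ≤ u := by
    obtain ⟨s, -, hs⟩ := hyα 0 0
    obtain ⟨t, -, ht⟩ := hzβ 0 0
    refine ⟨v 0 + s + t, ?_⟩
    filter_upwards [eventually_atTop.2 hs, eventually_atTop.2 ht] with i hi hi'
    exact (h 0 i).trans (add_le_add (add_le_add le_rfl hi) hi')
  have hu0 : 0 ≤ u := by
    obtain ⟨i, hi⟩ := hu.exists
    exact (abs_nonneg _).trans hi
  have h3 : (0 : ℝ) < 3 := by norm_num
  let c : Option (Bool × ℕ × ℕ) → ℕ → Z := fun k => match k with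
    | none => v
    | some (true, n, j) => α n j
    | some (false, n, j) => β n j
  have hc : ∀ k, Antitone (c k) ∧ IsGLB (range (c k)) 0 := by
    rintro (_ | ⟨_ | _, n, j⟩)
    exacts [⟨hv, hv'⟩, ⟨(hβ n).antitone j, (hβ n).isGLB j⟩, ⟨(hα n).antitone j, (hα n).isGLB j⟩]
  refine DLim.of_countable hZ (c := fun k l => (3 : ℝ) • c k l)
    (fun k i j hij => smul_le_smul_of_nonneg_left ((hc k).1 hij) h3.le)
    (fun k => isGLB_range_smul (hc k).2 h3) hu0 fun Φ s hs => ?_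
  -- The row `v` selects `n`; after that only the rows of the two regulators belonging to this `n`
  -- are used.
  set n := Φ none
  obtain ⟨p, hp, hyp⟩ := hyα n fun j => Φ (some (true, n, j))
  obtain ⟨q, hq, hzq⟩ := hzβ n fun j => Φ (some (false, n, j))
  filter_upwards [hu, eventually_atTop.2 hyp, eventually_atTop.2 hzq] with i hi hip hiq
  exact le_of_inf_smul_le hi ((h n i).trans (add_le_add (add_le_add le_rfl hip) hiq)) (hs none)
    (inf_smul_le_of_isLUB h3 hp fun j => hs (some (true, n, j)))
    (inf_smul_le_of_isLUB h3 hq fun j => hs (some (false, n, j)))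

end DConvergence

/-! ### Limits from a Cauchy estimate -/

section Order

variable {Z : Type*} [AddCommGroup Z] [Lattice Z] [IsOrderedAddMonoid Z]

/-- Every left endpoint `L n - v n` lies below every right endpoint `L m + v m`, so the supremum of
the left endpoints lies in all the intervals. -/
theorem DedekindComplete.exists_forall_abs_sub_le (hZ : DedekindComplete Z) {L v : ℕ → Z}
    (h : ∀ n m, L n - L m ≤ v n + v m) : ∃ l, ∀ n, |L n - l| ≤ v n := by
  have h' : ∀ n m, L n - v n ≤ L m + v m := fun n m => by
    have := sub_nonneg.2 (h n m)
    rw [← sub_nonneg]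
    exact this.trans (le_of_eq (by abel))
  obtain ⟨l, hl⟩ := hZ (range fun n => L n - v n) (range_nonempty _)
    ⟨L 0 + v 0, by rintro _ ⟨n, rfl⟩; exact h' n 0⟩
  refine ⟨l, fun n => abs_le_of_le_of_neg_le ?_ ?_⟩
  · exact sub_le_comm.1 (hl.1 ⟨n, rfl⟩)
  · rw [neg_sub, sub_le_iff_le_add']
    exact hl.2 (by rintro _ ⟨m, rfl⟩; exact h' m n)

theorem OLim.of_forall_abs_sub_le {L v : ℕ → Z} {l : Z} (hv : Antitone v)
    (hv' : IsGLB (range v) 0) (h : ∀ n, |L n - l| ≤ v n) : OLim ℕ L l := by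
  have hv0 : ∀ n, 0 ≤ v n := fun n => hv'.1 ⟨n, rfl⟩
  refine ⟨ℕ, inferInstance, inferInstance, inferInstance, fun n => l - v n, fun n => l + v n,
    fun i j hij => sub_le_sub_left (hv hij) l, fun i j hij => add_le_add_right (hv hij) l,
    ⟨?_, fun t ht => ?_⟩, ⟨?_, fun t ht => ?_⟩, fun c => ⟨c, fun i hi => ⟨?_, ?_⟩⟩⟩
  · rintro _ ⟨n, rfl⟩
    exact sub_le_self _ (hv0 n)
  · refine sub_nonpos.1 (hv'.2 ?_)
    rintro _ ⟨n, rfl⟩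
    exact sub_le_comm.1 (ht ⟨n, rfl⟩)
  · rintro _ ⟨n, rfl⟩
    exact le_add_of_nonneg_right (hv0 n)
  · refine sub_nonpos.1 (hv'.2 ?_)
    rintro _ ⟨n, rfl⟩
    exact sub_le_iff_le_add'.2 (ht ⟨n, rfl⟩)
  · refine sub_le_comm.1 (le_trans ?_ ((h i).trans (hv hi)))
    rw [← neg_sub]
    exact neg_le_abs _
  · exact sub_le_iff_le_add'.1 ((le_abs_self _).trans ((h i).trans (hv hi)))

end Order

/-! ### Riemann sums and integrals -/

section Integral

variable {Ω X Y Z : Type*}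
  [AddCommGroup X] [Lattice X] [IsOrderedAddMonoid X] [Module ℝ X]
  [AddCommGroup Y] [Lattice Y] [Module ℝ Y]
  [AddCommGroup Z] [Lattice Z] [IsOrderedAddMonoid Z] [Module ℝ Z]
  {H : Set (Set Ω)} {Γ : Type w}

theorem riemannSum_sub_le {B : X →ₗ[ℝ] Y →ₗ[ℝ] Z}
    (hB : ∀ x y, 0 ≤ x → 0 ≤ y → 0 ≤ B x y) (N : IntegrationNet H Γ) {μ : H → Y}
    (hμ : ∀ A, 0 ≤ μ A) {f g : Ω → X} {u : X} (h : ∀ ω, f ω - g ω ≤ u) (γ : Γ) :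
    riemannSum B N f μ γ - riemannSum B N g μ γ ≤ riemannSum B N (fun _ => u) μ γ := by
  let _ := N.fintype γ
  unfold riemannSum
  rw [← Finset.sum_sub_distrib]
  refine Finset.sum_le_sum fun i _ => ?_
  have := hB _ _ (sub_nonneg.2 (h (N.τ γ i))) (hμ (N.σ γ i))
  simpa only [map_sub, LinearMap.sub_apply, sub_nonneg] using this

theorem abs_riemannSum_sub_le {B : X →ₗ[ℝ] Y →ₗ[ℝ] Z}
    (hB : ∀ x y, 0 ≤ x → 0 ≤ y → 0 ≤ B x y) (N : IntegrationNet H Γ) {μ : H → Y}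
    (hμ : ∀ A, 0 ≤ μ A) {f g : Ω → X} {u : X} (h : ∀ ω, |f ω - g ω| ≤ u) (γ : Γ) :
    |riemannSum B N f μ γ - riemannSum B N g μ γ| ≤ riemannSum B N (fun _ => u) μ γ := by
  refine abs_le_of_le_of_neg_le
    (riemannSum_sub_le hB N hμ (fun ω => (le_abs_self _).trans (h ω)) γ) ?_
  rw [neg_sub]
  refine riemannSum_sub_le hB N hμ (fun ω => ?_) γ
  rw [← neg_sub]
  exact (neg_le_abs _).trans (h ω)

variable [Preorder Γ] [IsDirectedOrder Γ] [Nonempty Γ]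

theorem hasNetIntegral_const {η₁ : NetLim.{w} X} {η₂ : NetLim.{w} Y} {η₃ : NetLim.{w} Z}
    {B : X →ₗ[ℝ] Y →ₗ[ℝ] Z} (hB : IsProduct η₁ η₂ η₃ B) {N : IntegrationNet H Γ} {μ : H → Y}
    (hμ : IsRegularIntegrator η₂ N μ) (hH : Set.univ ∈ H) (x : X) :
    HasNetIntegral η₃ B N (fun _ => x) μ (B x (μ ⟨Set.univ, hH⟩)) := by
  have h := hB.continuous_right x Γ _ _ (hμ ⟨Set.univ, hH⟩)
  have e : riemannSum B N (fun _ => x) μ = fun γ => B x (riemannSum (LinearMap.lsmul ℝ Y) N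
      ((Set.univ : Set Ω).indicator fun _ => (1 : ℝ)) μ γ) := by
    funext γ
    simp [riemannSum]
  rw [HasNetIntegral, e]
  exact h

theorem netIntegral_spec {η : NetLim.{w} Z} {B : X →ₗ[ℝ] Y →ₗ[ℝ] Z} {N : IntegrationNet H Γ}
    {f : Ω → X} {μ : H → Y} (h : NetIntegrable η B N f μ) :
    HasNetIntegral η B N f μ (netIntegral η B N f μ) := by
  rw [netIntegral, dif_pos h]
  exact h.choose_spec

theorem isGLB_range_apply_of_isProduct (hZ' : WeaklySigmaDistributive Z)
    {η₁ : NetLim.{w} X} (hη₁ : SequentialMCP η₁) {η₂ : NetLim.{w} Y}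
    {B : X →ₗ[ℝ] Y →ₗ[ℝ] Z} (hB : IsProduct η₁ η₂ DLim B) {y : Y} (hy : 0 ≤ y)
    {u : ℕ → X} (hu : Antitone u) (hu' : IsGLB (range u) 0) :
    IsGLB (range fun n => B (u n) y) 0 := by
  refine ⟨?_, fun t ht => ?_⟩
  · rintro _ ⟨n, rfl⟩
    simpa using hB.isotone le_rfl (hu'.1 ⟨n, rfl⟩) hy le_rfl
  have hlim : η₁ (ULift.{w} ℕ) (fun n => -u n.down) 0 := by
    refine hη₁ _ 0 (fun i j hij => neg_le_neg (hu hij)) ⟨?_, fun s hs => ?_⟩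
    · rintro _ ⟨n, rfl⟩
      exact neg_nonpos.2 (hu'.1 ⟨n.down, rfl⟩)
    · refine neg_nonpos.1 (hu'.2 ?_)
      rintro _ ⟨n, rfl⟩
      exact neg_le.1 (hs ⟨⟨n⟩, rfl⟩)
  -- Each `s ∈ A` dominates some `B (u n) y`, hence also the lower bound `t`.
  obtain ⟨A, hA, h⟩ := DLim.exists_isGLB hZ' (hB.continuous_left y _ _ _ hlim)
  refine hA.2 fun s hs => ?_
  obtain ⟨n, hn⟩ := (h s hs).exists
  simp only [map_neg, LinearMap.neg_apply, map_zero, LinearMap.zero_apply, sub_zero] at hn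
  exact (ht ⟨n.down, rfl⟩).trans ((neg_neg (B (u n.down) y) ▸ neg_le_abs _).trans hn)

/-- The inequality for Riemann sums passes to the limit by comparing all three nets at one common
`γ`. -/
theorem netIntegral_sub_le (hZ' : WeaklySigmaDistributive Z) {B : X →ₗ[ℝ] Y →ₗ[ℝ] Z}
    (hB : ∀ x y, 0 ≤ x → 0 ≤ y → 0 ≤ B x y) {N : IntegrationNet H Γ} {μ : H → Y}
    (hμ : ∀ A, 0 ≤ μ A) {f g : Ω → X} {u : X} (h : ∀ ω, f ω - g ω ≤ u) {a b c : Z}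
    (hf : HasNetIntegral DLim B N f μ a) (hg : HasNetIntegral DLim B N g μ b)
    (hu : HasNetIntegral DLim B N (fun _ => u) μ c) : a - b ≤ c := by
  obtain ⟨A₁, hA₁, h₁⟩ := DLim.exists_isGLB hZ' hf
  obtain ⟨A₂, hA₂, h₂⟩ := DLim.exists_isGLB hZ' hg
  obtain ⟨A₃, hA₃, h₃⟩ := DLim.exists_isGLB hZ' hu
  refine sub_nonpos.1 (hA₃.2 fun s₃ hs₃ => sub_nonpos.1 (le_zero_of_forall_le_add hA₁ hA₂
    fun s₁ hs₁ s₂ hs₂ => ?_))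
  obtain ⟨γ, hγ₁, hγ₂, hγ₃⟩ := ((h₁ s₁ hs₁).and ((h₂ s₂ hs₂).and (h₃ s₃ hs₃))).exists
  set F := riemannSum B N f μ γ
  set G := riemannSum B N g μ γ
  set U := riemannSum B N (fun _ => u) μ γ
  have hFG : F - G - U ≤ 0 := sub_nonpos.2 (riemannSum_sub_le hB N hμ h γ)
  have e₁ : a - F ≤ s₁ := by
    rw [← neg_sub]; exact (neg_le_abs _).trans hγ₁
  have e₂ : G - b ≤ s₂ := (le_abs_self _).trans hγ₂
  have e₃ : U - c ≤ s₃ := (le_abs_self _).trans hγ₃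
  calc a - b - c - s₃ = (a - F) + (G - b) + ((U - c) - s₃) + (F - G - U) := by abel
    _ ≤ s₁ + s₂ + 0 + 0 :=
      add_le_add (add_le_add (add_le_add e₁ e₂) (sub_nonpos.2 e₃)) hFG
    _ = s₁ + s₂ := by simp

end Integral

end NetRiemann

theorem mainTheorem1
    {Ω X Y Z : Type*}
    [AddCommGroup X] [Lattice X] [IsOrderedAddMonoid X] [Module ℝ X] [IsOrderedModule ℝ X]
    [AddCommGroup Y] [Lattice Y] [IsOrderedAddMonoid Y] [Module ℝ Y] [IsOrderedModule ℝ Y]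
    [AddCommGroup Z] [Lattice Z] [IsOrderedAddMonoid Z] [Module ℝ Z] [IsOrderedModule ℝ Z]
    (hZ : DedekindComplete Z) (hZ' : WeaklySigmaDistributive Z)
    (η₁ : NetLim.{w} X) (hη₁ : IsBoccutoCandeloro η₁) (hη₁' : SequentialMCP η₁)
    (η₂ : NetLim.{w} Y) (hη₂ : IsBoccutoCandeloro η₂)
    (B : X →ₗ[ℝ] Y →ₗ[ℝ] Z) (hB : IsProduct η₁ η₂ DLim B)
    (H : Set (Set Ω)) (hH_empty : ∅ ∈ H) (hH_univ : Set.univ ∈ H)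
    {Γ : Type w} [Preorder Γ] [IsDirectedOrder Γ] [Nonempty Γ] (N : IntegrationNet H Γ)
    (μ : H → Y) (hμ_nonneg : ∀ A, 0 ≤ μ A) (hμ : IsRegularIntegrator η₂ N μ)
    (f : ℕ → Ω → X) (g : Ω → X)
    (hf : ∀ n, NetIntegrable DLim B N (f n) μ) (hfg : OrderUniformLim f g) :
    NetIntegrable DLim B N g μ ∧
      OLim ℕ (fun n => netIntegral DLim B N (f n) μ) (netIntegral DLim B N g μ) := by
  obtain ⟨u, hu0, hu, hu', hfg⟩ := hfg
  have hBpos : ∀ x y, 0 ≤ x → 0 ≤ y → 0 ≤ B x y := fun x y hx hy => by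
    simpa using hB.isotone le_rfl hx hy le_rfl
  set m := μ ⟨Set.univ, hH_univ⟩
  have hm : 0 ≤ m := hμ_nonneg _
  set v : ℕ → Z := fun n => B (u n) m with hv_def
  have hv : Antitone v := fun i j hij => hB.isotone (hu0 j) (hu hij) hm le_rfl
  have hv' : IsGLB (Set.range v) 0 := isGLB_range_apply_of_isProduct hZ' hη₁' hB hm hu hu'
  have hint := hasNetIntegral_const hB hμ hH_univ
  have hL := fun n => netIntegral_spec (hf n)
  obtain ⟨l, hl⟩ := hZ.exists_forall_abs_sub_le (v := v) fun n k => by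
    have := netIntegral_sub_le hZ' hBpos hμ_nonneg (u := u n + u k) (fun ω => ?_)
      (hL n) (hL k) (hint _)
    · simpa using this
    · calc f n ω - f k ω = (f n ω - g ω) + -(f k ω - g ω) := by abel
        _ ≤ u n + u k := add_le_add ((le_abs_self _).trans (hfg n ω))
          ((neg_le_abs _).trans (hfg k ω))
  have hg : HasNetIntegral DLim B N g μ l := by
    refine DLim.of_approx (v := fun n => (2 : ℝ) • v n) hZ hL (fun n => hint (u n))
      (fun i j hij => smul_le_smul_of_nonneg_left (hv hij) zero_le_two)
      (isGLB_range_smul hv' two_pos) fun n γ => ?_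
    have h₁ := abs_riemannSum_sub_le hBpos N hμ_nonneg (hfg n) γ
    set F := riemannSum B N (f n) μ γ
    set G := riemannSum B N g μ γ
    set U := riemannSum B N (fun _ => u n) μ γ
    set L := netIntegral DLim B N (f n) μ
    rw [abs_sub_comm] at h₁
    -- One copy of `v n` comes from the limit of `U`, the other from `|L - l|`; hence the `2 • v n`.
    have h₂ : U ≤ v n + |U - v n| := sub_le_iff_le_add'.1 (le_abs_self _)
    calc |G - l| = |(G - F) + ((F - L) + (L - l))| := by congr 1; abel
      _ ≤ |G - F| + |(F - L) + (L - l)| := abs_add_le_add_abs _ _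
      _ ≤ (v n + |U - v n|) + (|F - L| + v n) := add_le_add (h₁.trans h₂)
        ((abs_add_le_add_abs _ _).trans (add_le_add le_rfl (hl n)))
      _ = (2 : ℝ) • v n + |F - L| + |U - v n| := by rw [two_smul]; abel
  have hgi : NetIntegrable DLim B N g μ := ⟨l, hg⟩
  refine ⟨hgi, ?_⟩
  rw [DLim.unique hZ' (netIntegral_spec hgi) hg]
  exact OLim.of_forall_abs_sub_le hv hv' hl
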